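/- A \emph{matchgate} is a two-qubit operation whose matrix in the standard basis $|00\rangle,|01\rangle,|10\rangle,|11\rangle$ is $$G=\begin{pmatrix} a&0&0&b\\0&u&v&0\\0&x&y&0\\c&0&0&d\end{pmatrix},\qquad A=\begin{pmatrix}a&b\\c&d\end{pmatrix}\in SU(2),\quad B=\begin{pmatrix}u&v\\x&y\end{pmatrix}\in SU(2).$$ A \emph{matchgate circuit} on $m$ qubits arranged on a line is a finite product of matchgates, each acting on two nearest-neighbor qubits $i,i+1$. A function $f:\{0,1\}^n\to\{0,1\}$ is \emph{matchgate-computable with probability at least $p$} if there are $m\ge n$ (with $m\geq 1$) and a matchgate circuit $U$ on $m$ qubits such that, for every $x\in\{0,1\}^n$, a computational basis measurement of the first qubit of the state $U|x,0\rangle$ (where $0$ is a string of $m-n$ zeros) yields the outcome $f(x)$ with probability at least $p$. The function $f$ \emph{depends on its $k$-th bit} if $f(x)\neq f(x_{\neg k})$ for some $x$, where $x_{\neg k}$ is $x$ with its $k$-th bit flipped. \textbf{Theorem.} Let $f:\{0,1\}^n\to\{0,1\}$ be a boolean function and let $p\in(3/4,1]$. Then $f$ is matchgate-computable with probability at least $p$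 if and only if $f$ is constant or depends on exactly one bit of its input. Moreover, $f$ depends on exactly one bit of its input if and only if there is a $k$ such that $f(x)=x_k$ for all $x$, or $f(x)=1-x_k$ for all $x$. -/

import Mathlib

namespace MatchgateLTG

open scoped Matrix

noncomputable section

/-- Bit strings of length `n`; they also label the computational basis of `n` qubits.
Qubits and bits are numbered from `0` to `n - 1`, so the first qubit is qubit `0`. -/
abbrev BitString (n : ℕ) := Fin n → Fin 2

/-- The two-qubit operation whose matrix in the standard basis `|00⟩, |01⟩, |10⟩, |11⟩` is
`[[a, 0, 0, b], [0, u, v, 0], [0, x, y, 0], [c, 0, 0, d]]`, where `A = [[a, b], [c, d]]` acts on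
the span of `|00⟩, |11⟩` and `B = [[u, v], [x, y]]` acts on the span of `|01⟩, |10⟩`.
In both blocks the position of a basis vector is given by its first bit. -/
def matchgateMatrix (A B : Matrix (Fin 2) (Fin 2) ℂ) :
    Matrix (Fin 2 × Fin 2) (Fin 2 × Fin 2) ℂ :=
  fun r s =>
    if r.1 = r.2 ∧ s.1 = s.2 then A r.1 s.1
    else if r.1 ≠ r.2 ∧ s.1 ≠ s.2 then B r.1 s.1
    else 0

/-- A matchgate: both blocks belong to `SU(2)`. -/
def IsMatchgate (G : Matrix (Fin 2 × Fin 2) (Fin 2 × Fin 2) ℂ) : Prop :=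
  ∃ A ∈ Matrix.specialUnitaryGroup (Fin 2) ℂ, ∃ B ∈ Matrix.specialUnitaryGroup (Fin 2) ℂ,
    G = matchgateMatrix A B

/-- The operation on `m` qubits that applies the two-qubit operation `G` to the qubits `i` and `j`
(in this order) and the identity to all other qubits. -/
def applyGate {m : ℕ} (G : Matrix (Fin 2 × Fin 2) (Fin 2 × Fin 2) ℂ) (i j : Fin m) :
    Matrix (BitString m) (BitString m) ℂ :=
  fun r s => if ∀ l, l ≠ i → l ≠ j → r l = s l then G (r i, r j) (s i, s j) else 0

/-- The `m`-qubit operations implemented by a single matchgate acting on two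
nearest-neighbor qubits of a line. -/
def nearestNeighborMatchgates (m : ℕ) : Set (Matrix (BitString m) (BitString m) ℂ) :=
  {U | ∃ G, IsMatchgate G ∧ ∃ i j : Fin m, (j : ℕ) = (i : ℕ) + 1 ∧ U = applyGate G i j}

/-- The `m`-qubit operations implemented by matchgate circuits: finite products of
nearest-neighbor matchgates. -/
def matchgateCircuits (m : ℕ) : Submonoid (Matrix (BitString m) (BitString m) ℂ) :=
  Submonoid.closure (nearestNeighborMatchgates m)

/-- The `m`-bit string `(x, 0)`: the string `x` followed by `m - n` zeros (used for `n ≤ m`). -/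
def padZero {n : ℕ} (m : ℕ) (x : BitString n) : BitString m :=
  fun j => if h : (j : ℕ) < n then x ⟨j, h⟩ else 0

/-- The computational basis state `|z⟩`. -/
def basisState {m : ℕ} (z : BitString m) : BitString m → ℂ := Pi.single z 1

/-- The probability that a computational basis measurement of qubit `i` of the state `ψ`
yields the outcome `b`. -/
def outcomeProb {m : ℕ} (ψ : BitString m → ℂ) (i : Fin m) (b : Fin 2) : ℝ :=
  ∑ z : BitString m, if z i = b then ‖ψ z‖ ^ 2 else 0

/-- `U` computes `f` with probability at least `p`: for every input `x`, measuring the first qubit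
of `U|x, 0⟩` yields `f x` with probability at least `p`. -/
def ComputesWithProb {n m : ℕ} (hm : 0 < m) (U : Matrix (BitString m) (BitString m) ℂ)
    (f : BitString n → Fin 2) (p : ℝ) : Prop :=
  ∀ x : BitString n, p ≤ outcomeProb (U *ᵥ basisState (padZero m x)) ⟨0, hm⟩ (f x)

/-- `f` is matchgate-computable with probability at least `p`: some matchgate circuit on
`m ≥ n` qubits computes `f` with probability at least `p`. (There must be a qubit to measure,
so `m` is positive; this only matters for `n = 0`.) -/
def MatchgateComputable {n : ℕ} (f : BitString n → Fin 2) (p : ℝ) : Prop :=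
  ∃ (m : ℕ) (hm : 0 < m), n ≤ m ∧ ∃ U ∈ matchgateCircuits m, ComputesWithProb hm U f p

/-- The string obtained from `x` by flipping its `k`-th bit. -/
def flipBit {n : ℕ} (x : BitString n) (k : Fin n) : BitString n :=
  Function.update x k (1 - x k)

/-- `f` depends on its `k`-th variable. -/
def DependsOnBit {n : ℕ} (f : BitString n → Fin 2) (k : Fin n) : Prop :=
  ∃ x : BitString n, f x ≠ f (flipBit x k)

/-- `f` is constant. -/
def IsConstant {n : ℕ} (f : BitString n → Fin 2) : Prop :=
  ∃ b : Fin 2, ∀ x, f x = b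

/-- `f` depends on a single bit of its input: on exactly one of its variables. -/
def DependsOnSingleBit {n : ℕ} (f : BitString n → Fin 2) : Prop :=
  ∃! k : Fin n, DependsOnBit f k

end

end MatchgateLTG

namespace MatchgateLTG

open scoped Matrix

/-! ### Boolean functions and the bits they depend on. -/

section BooleanFunctions

variable {n : ℕ} {f : BitString n → Fin 2}

/-! Matchgates are free-fermion evolutions: conjugation by a matchgate circuit maps the span of the
Jordan-Wigner ladder operators into itself (`exists_ladderSpan_mul_eq`). Up to a unitary, the
probability of an outcome is therefore the squared norm of a combination of ladder operators applied
to `|y⟩`. Its terms flip different bits of `y`, so they do not interfere, and the probability of `b`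
is `∑ q, w q (b - y q)` with nonnegative weights of total 1 (`exists_weights`).

If `f` depends on bit `k`, add the success probabilities at `x` and at its flip. With `W k = w k 0 +
w k 1`, every other bit contributes its whole weight and bit `k` at most `2 * W k`, so `2 * p ≤ 1 +
W k` (`weight_ge_of_dependsOnBit`). For `p > 3/4` this gives `W k > 1/2`, which two different bits
cannot both satisfy.

Conversely, swaps up to phase carry any input bit, or a padding zero for constants, to the first
qubit, where it can be negated (`matchgateComputable_of_bit`). -/

lemma flipBit_apply_self (x : BitString n) (k : Fin n) : flipBit x k k = 1 - x k := by
  simp [flipBit]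

lemma flipBit_apply_of_ne (x : BitString n) {k l : Fin n} (h : l ≠ k) :
    flipBit x k l = x l := by
  simp [flipBit, h]

lemma one_sub_one_sub (b : Fin 2) : 1 - (1 - b) = b := by
  revert b; decide

lemma one_sub_ne_self (b : Fin 2) : 1 - b ≠ b := by
  revert b; decide

lemma eq_one_sub_of_ne {a b : Fin 2} (h : a ≠ b) : a = 1 - b := by
  revert a b; decide

lemma flipBit_flipBit (x : BitString n) (k : Fin n) : flipBit (flipBit x k) k = x := by
  ext l
  by_cases h : l = k
  · subst h; simp [flipBit_apply_self]
  · simp [flipBit_apply_of_ne _ h]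

lemma eq_flipBit_iff {r s : BitString n} {k : Fin n} : s = flipBit r k ↔ r = flipBit s k := by
  constructor <;> rintro rfl <;> rw [flipBit_flipBit]

lemma flipBit_injective (x : BitString n) : Function.Injective (flipBit x) := by
  intro k l h
  by_contra hkl
  have := congrFun h k
  rw [flipBit_apply_self, flipBit_apply_of_ne _ hkl] at this
  exact one_sub_ne_self _ this

/-- Two inputs that agree on all bits on which `f` depends have the same value. -/
lemma apply_eq_of_agree (x y : BitString n) (h : ∀ k, DependsOnBit f k → x k = y k) :
    f x = f y := by
  -- Induction on the Hamming distance: `f` does not depend on a bit where `x` and `y` differ, so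
  -- that bit of `x` can be flipped.
  generalize hc : (Finset.univ.filter fun k => x k ≠ y k).card = c
  induction c generalizing x with
  | zero =>
    rw [Finset.card_eq_zero, Finset.filter_eq_empty_iff] at hc
    congr 1
    ext k
    simpa using congrArg Fin.val (not_not.mp (hc (Finset.mem_univ k)))
  | succ c ih =>
    obtain ⟨k, hk⟩ := Finset.card_pos.mp (by omega : 0 < (Finset.univ.filter fun k => x k ≠ y k).card)
    have hk' : x k ≠ y k := by simpa using hk
    have hnd : ¬ DependsOnBit f k := fun hd => hk' (h k hd)
    have hflip : f x = f (flipBit x k) := by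
      by_contra hne
      exact hnd ⟨x, hne⟩
    rw [hflip]
    apply ih
    · intro l hl
      have : l ≠ k := fun e => hnd (e ▸ hl)
      rw [flipBit_apply_of_ne _ this, h l hl]
    · have : (Finset.univ.filter fun l => flipBit x k l ≠ y l) =
          (Finset.univ.filter fun l => x l ≠ y l).erase k := by
        ext l
        by_cases hl : l = k
        · subst hl
          simp [flipBit_apply_self, ← eq_one_sub_of_ne hk'.symm]
        · simp [flipBit_apply_of_ne _ hl, hl]
      rw [this, Finset.card_erase_of_mem hk, hc]
      simp

lemma dependsOnSingleBit_iff :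
    DependsOnSingleBit f ↔ ∃ k : Fin n, (∀ x, f x = x k) ∨ (∀ x, f x = 1 - x k) := by
  constructor
  · rintro ⟨k, ⟨x, hx⟩, huniq⟩
    have key : ∀ y z : BitString n, y k = z k → f y = f z := fun y z hyz =>
      apply_eq_of_agree y z fun l hl => by rw [huniq l hl]; exact hyz
    refine ⟨k, ?_⟩
    have hx' := eq_one_sub_of_ne hx.symm
    by_cases h : f x = x k
    · left
      intro y
      by_cases hy : y k = x k
      · rw [key y x hy, h, hy]
      · rw [key y (flipBit x k) (by rw [flipBit_apply_self, eq_one_sub_of_ne hy]), hx', h,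
          eq_one_sub_of_ne hy]
    · right
      have h := eq_one_sub_of_ne h
      intro y
      by_cases hy : y k = x k
      · rw [key y x hy, h, hy]
      · rw [key y (flipBit x k) (by rw [flipBit_apply_self, eq_one_sub_of_ne hy]), hx', h,
          eq_one_sub_of_ne hy]
  · rintro ⟨k, h⟩
    have hval : ∀ x y : BitString n, f x ≠ f y ↔ x k ≠ y k := by
      intro x y
      rcases h with h | h
      · rw [h, h]
      · rw [h, h, Ne, sub_right_inj]
    refine ⟨k, ⟨fun _ => 0, (hval _ _).mpr ?_⟩, ?_⟩
    · rw [flipBit_apply_self]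
      exact (one_sub_ne_self _).symm
    · rintro l ⟨x, hx⟩
      by_contra hl
      exact (hval _ _).mp hx (flipBit_apply_of_ne x (Ne.symm hl)).symm

lemma isConstant_or_dependsOnSingleBit
    (h : ∀ k l, DependsOnBit f k → DependsOnBit f l → k = l) :
    IsConstant f ∨ DependsOnSingleBit f := by
  by_cases hk : ∃ k, DependsOnBit f k
  · obtain ⟨k, hk⟩ := hk
    exact Or.inr ⟨k, hk, fun l hl => h l k hl hk⟩
  · exact Or.inl ⟨f 0, fun x => apply_eq_of_agree x 0 fun k hd => (hk ⟨k, hd⟩).elim⟩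

end BooleanFunctions

/-! ### Gates as matrices on `m` qubits, and unitarity of circuits. -/

section Gates

variable {m : ℕ}

/-- Reduces the sum over intermediate strings in a product of gates on `i, j` to the four values of
the two bits. -/
lemma sum_agree_off_pair {i j : Fin m} (hij : i ≠ j) (z : BitString m) (F : BitString m → ℂ) :
    (∑ s : BitString m, if ∀ l, l ≠ i → l ≠ j → z l = s l then F s else 0) =
      ∑ t : Fin 2 × Fin 2, F (Function.update (Function.update z i t.1) j t.2) := by
  rw [← Finset.sum_filter]
  refine Finset.sum_nbij' (fun s => (s i, s j))
    (fun t => Function.update (Function.update z i t.1) j t.2) ?_ ?_ ?_ ?_ ?_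
  · simp
  · intro t _
    simp only [Finset.mem_filter, Finset.mem_univ, true_and]
    intro l hi hj
    simp [hi, hj]
  · intro s hs
    simp only [Finset.mem_filter, Finset.mem_univ, true_and] at hs
    funext l
    by_cases hj : l = j
    · subst hj; simp
    · by_cases hi : l = i
      · subst hi; simp [hj]
      · simp [hi, hj, hs l hi hj]
  · intro t _
    simp [hij]
  · intro s hs
    simp only [Finset.mem_filter, Finset.mem_univ, true_and] at hs
    congr 1
    funext l
    by_cases hj : l = j
    · subst hj; simp
    · by_cases hi : l = i
      · subst hi; simp [hj]
      · simp [hi, hj, hs l hi hj]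

lemma applyGate_mul {i j : Fin m} (hij : i ≠ j)
    (G H : Matrix (Fin 2 × Fin 2) (Fin 2 × Fin 2) ℂ) :
    applyGate (G * H) i j = applyGate G i j * applyGate H i j := by
  ext r s
  have h1 : (applyGate G i j * applyGate H i j) r s =
      ∑ z : BitString m, if ∀ l, l ≠ i → l ≠ j → r l = z l then
        G (r i, r j) (z i, z j) * applyGate H i j z s else 0 := by
    rw [Matrix.mul_apply]
    refine Finset.sum_congr rfl fun z _ => ?_
    rw [applyGate]
    split_ifs <;> simp
  rw [h1, sum_agree_off_pair hij]
  have h2 : ∀ t : Fin 2 × Fin 2,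
      (∀ l, l ≠ i → l ≠ j → Function.update (Function.update r i t.1) j t.2 l = s l) ↔
        ∀ l, l ≠ i → l ≠ j → r l = s l := by
    intro t
    refine forall_congr' fun l => forall_congr' fun hi => forall_congr' fun hj => ?_
    simp [hi, hj]
  simp only [applyGate, h2]
  split_ifs with h
  · rw [Matrix.mul_apply]
    simp [hij]
  · simp

lemma applyGate_one {i j : Fin m} : applyGate 1 i j = 1 := by
  ext r s
  rw [applyGate, Matrix.one_apply, Matrix.one_apply]
  by_cases h : r = s
  · simp [h]
  · rw [if_neg h]
    split_ifs with h1 h2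
    · refine (h (funext fun l => ?_)).elim
      simp only [Prod.mk.injEq] at h2
      by_cases hi : l = i
      · rw [hi, h2.1]
      · by_cases hj : l = j
        · rw [hj, h2.2]
        · exact h1 l hi hj
    · rfl
    · rfl

lemma applyGate_conjTranspose {i j : Fin m} (G : Matrix (Fin 2 × Fin 2) (Fin 2 × Fin 2) ℂ) :
    (applyGate G i j)ᴴ = applyGate Gᴴ i j := by
  ext r s
  simp only [Matrix.conjTranspose_apply, applyGate, eq_comm (a := s _)]
  split_ifs <;> simp

lemma matchgateMatrix_mul (A B A' B' : Matrix (Fin 2) (Fin 2) ℂ) :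
    matchgateMatrix A B * matchgateMatrix A' B' = matchgateMatrix (A * A') (B * B') := by
  ext ⟨r₁, r₂⟩ ⟨s₁, s₂⟩
  fin_cases r₁ <;> fin_cases r₂ <;> fin_cases s₁ <;> fin_cases s₂ <;>
    simp [matchgateMatrix, Matrix.mul_apply, Fintype.sum_prod_type, Fin.sum_univ_two]

lemma matchgateMatrix_one : matchgateMatrix 1 1 = 1 := by
  ext ⟨r₁, r₂⟩ ⟨s₁, s₂⟩
  fin_cases r₁ <;> fin_cases r₂ <;> fin_cases s₁ <;> fin_cases s₂ <;>
    simp [matchgateMatrix]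

lemma matchgateMatrix_conjTranspose (A B : Matrix (Fin 2) (Fin 2) ℂ) :
    (matchgateMatrix A B)ᴴ = matchgateMatrix Aᴴ Bᴴ := by
  ext ⟨r₁, r₂⟩ ⟨s₁, s₂⟩
  fin_cases r₁ <;> fin_cases r₂ <;> fin_cases s₁ <;> fin_cases s₂ <;>
    simp [matchgateMatrix, Matrix.conjTranspose_apply]

lemma conjTranspose_mul_self_of_mem_circuits {U : Matrix (BitString m) (BitString m) ℂ}
    (hU : U ∈ matchgateCircuits m) : Uᴴ * U = 1 := by
  induction hU using Submonoid.closure_induction with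
  | mem U hU =>
    obtain ⟨G, ⟨A, hA, B, hB, rfl⟩, i, j, hij, rfl⟩ := hU
    have hne : i ≠ j := by rintro rfl; omega
    have hA' : Aᴴ * A = 1 :=
      Matrix.mem_unitaryGroup_iff'.mp (Matrix.mem_specialUnitaryGroup_iff.mp hA).1
    have hB' : Bᴴ * B = 1 :=
      Matrix.mem_unitaryGroup_iff'.mp (Matrix.mem_specialUnitaryGroup_iff.mp hB).1
    rw [applyGate_conjTranspose, ← applyGate_mul hne, matchgateMatrix_conjTranspose,
      matchgateMatrix_mul, hA', hB', matchgateMatrix_one, applyGate_one]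
  | one => simp
  | mul U V _ _ hU hV =>
    rw [Matrix.conjTranspose_mul, Matrix.mul_assoc, ← Matrix.mul_assoc Uᴴ, hU, Matrix.one_mul, hV]

end Gates

/-! ### Jordan-Wigner ladder operators under conjugation by matchgates. -/

section LadderOperators

variable {m : ℕ}

/-- The sign `(-1)^b`. -/
noncomputable def bitSign (b : Fin 2) : ℂ := if b = 0 then 1 else -1

/-- The Jordan-Wigner sign of the bits in front of position `q`. -/
noncomputable def jwSign (q : Fin m) (z : BitString m) : ℂ := ∏ l ∈ Finset.Iio q, bitSign (z l)

lemma jwSign_congr {q : Fin m} {z w : BitString m} (h : ∀ l < q, z l = w l) :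
    jwSign q z = jwSign q w :=
  Finset.prod_congr rfl fun l hl => by rw [h l (Finset.mem_Iio.mp hl)]

lemma jwSign_flipBit (q : Fin m) (z : BitString m) : jwSign q (flipBit z q) = jwSign q z :=
  jwSign_congr fun _ hl => flipBit_apply_of_ne _ hl.ne

lemma jwSign_of_succ {i j : Fin m} (hij : (j : ℕ) = i + 1) (z : BitString m) :
    jwSign j z = jwSign i z * bitSign (z i) := by
  have : Finset.Iio j = insert i (Finset.Iio i) := by
    ext l
    simp only [Finset.mem_Iio, Finset.mem_insert, Fin.lt_def, Fin.ext_iff]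
    omega
  rw [jwSign, this, Finset.prod_insert (by simp), mul_comm]
  rfl

lemma star_jwSign (q : Fin m) (z : BitString m) : star (jwSign q z) = jwSign q z := by
  rw [jwSign, star_prod]
  refine Finset.prod_congr rfl fun l _ => ?_
  rw [bitSign]
  split_ifs <;> simp

lemma norm_jwSign (q : Fin m) (z : BitString m) : ‖jwSign q z‖ = 1 := by
  rw [jwSign, norm_prod]
  refine Finset.prod_eq_one fun l _ => ?_
  rw [bitSign]
  split_ifs <;> simp

/-- The sign at a later position sees `i` and `j` only through their joint parity. -/
lemma jwSign_eq_of_agree_off_pair {i j q : Fin m} (hij : i ≠ j) (hi : i < q) (hj : j < q)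
    {r s : BitString m} (h : ∀ l, l ≠ i → l ≠ j → r l = s l)
    (hs : bitSign (r i) * bitSign (r j) = bitSign (s i) * bitSign (s j)) :
    jwSign q r = jwSign q s := by
  have hi' : i ∈ (Finset.Iio q).erase j := by simp [hij, hi]
  have hj' : j ∈ Finset.Iio q := by simp [hj]
  rw [jwSign, jwSign, ← Finset.mul_prod_erase _ _ hj', ← Finset.mul_prod_erase _ _ hj',
    ← Finset.mul_prod_erase _ _ hi', ← Finset.mul_prod_erase _ _ hi', ← mul_assoc, ← mul_assoc,
    mul_comm (bitSign (r j)), mul_comm (bitSign (s j)), hs]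
  congr 1
  refine Finset.prod_congr rfl fun l hl => ?_
  simp only [Finset.mem_erase] at hl
  rw [h l hl.1 hl.2.1]

/-- The Jordan-Wigner ladder operator that sets qubit `q` from `1 - b` to `b`: the annihilation
operator for `b = 0`, the creation operator for `b = 1`. -/
noncomputable def ladder (q : Fin m) (b : Fin 2) : Matrix (BitString m) (BitString m) ℂ :=
  fun r s => if r q = b ∧ s = flipBit r q then jwSign q r else 0

lemma ladder_conjTranspose (q : Fin m) (b : Fin 2) : (ladder q b)ᴴ = ladder q (1 - b) := by
  ext r s
  rw [Matrix.conjTranspose_apply, ladder, ladder]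
  by_cases h : s = flipBit r q
  · subst h
    have : 1 - r q = b ↔ r q = 1 - b := by
      constructor
      · rintro rfl; rw [one_sub_one_sub]
      · intro h; rw [h, one_sub_one_sub]
    simp only [flipBit_apply_self, flipBit_flipBit, jwSign_flipBit, this, and_true]
    split_ifs
    · exact star_jwSign q r
    · simp
  · have h' : ¬ r = flipBit s q := fun e => h (eq_flipBit_iff.mpr e)
    simp [h, h']

lemma ladder_mulVec (q : Fin m) (b : Fin 2) (ψ : BitString m → ℂ) (z : BitString m) :
    (ladder q b *ᵥ ψ) z = if z q = b then jwSign q z * ψ (flipBit z q) else 0 := by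
  rw [Matrix.mulVec, dotProduct, Finset.sum_eq_single (flipBit z q)]
  · simp [ladder]
  · intro s _ hs
    simp [ladder, hs]
  · simp

/-- The two-qubit operation exchanging the even and the odd sector, with blocks `M` and `N`. -/
def oddMatrix (M N : Matrix (Fin 2) (Fin 2) ℂ) : Matrix (Fin 2 × Fin 2) (Fin 2 × Fin 2) ℂ :=
  fun r s =>
    if r.1 = r.2 ∧ s.1 ≠ s.2 then M r.1 s.1
    else if r.1 ≠ r.2 ∧ s.1 = s.2 then N r.1 s.1
    else 0

lemma oddMatrix_mul_matchgateMatrix (M N A B : Matrix (Fin 2) (Fin 2) ℂ) :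
    oddMatrix M N * matchgateMatrix A B = oddMatrix (M * B) (N * A) := by
  ext ⟨r₁, r₂⟩ ⟨s₁, s₂⟩
  fin_cases r₁ <;> fin_cases r₂ <;> fin_cases s₁ <;> fin_cases s₂ <;>
    simp [matchgateMatrix, oddMatrix, Matrix.mul_apply, Fintype.sum_prod_type, Fin.sum_univ_two]

lemma matchgateMatrix_mul_oddMatrix (M N A B : Matrix (Fin 2) (Fin 2) ℂ) :
    matchgateMatrix A B * oddMatrix M N = oddMatrix (A * M) (B * N) := by
  ext ⟨r₁, r₂⟩ ⟨s₁, s₂⟩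
  fin_cases r₁ <;> fin_cases r₂ <;> fin_cases s₁ <;> fin_cases s₂ <;>
    simp [matchgateMatrix, oddMatrix, Matrix.mul_apply, Fintype.sum_prod_type, Fin.sum_univ_two]

/-- At determinant 1 the adjugate is the inverse, and it reverses products; hence `M ↦ A⁻¹ M B` is
compatible with tying the second block to the first by `N = -M.adjugate`. -/
lemma oddMatrix_adjugate_mul_matchgateMatrix {A B : Matrix (Fin 2) (Fin 2) ℂ}
    (hA : A.det = 1) (hB : B.det = 1) (M : Matrix (Fin 2) (Fin 2) ℂ) :
    oddMatrix M (-M.adjugate) * matchgateMatrix A B =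
      matchgateMatrix A B *
        oddMatrix (A.adjugate * M * B) (-(A.adjugate * M * B).adjugate) := by
  rw [oddMatrix_mul_matchgateMatrix, matchgateMatrix_mul_oddMatrix]
  congr 1
  · rw [← Matrix.mul_assoc, ← Matrix.mul_assoc, Matrix.mul_adjugate, hA]
    simp
  · rw [Matrix.adjugate_mul_distrib, Matrix.adjugate_mul_distrib,
      Matrix.adjugate_adjugate _ (by simp)]
    simp only [hA, Matrix.mul_neg, ← Matrix.mul_assoc, Matrix.mul_adjugate, hB]
    simp

/-- The operator on neighboring qubits `i, j` given by an odd two-qubit operation, with the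
Jordan-Wigner sign in front of it. -/
noncomputable def oddPair (i j : Fin m) (M : Matrix (Fin 2) (Fin 2) ℂ) :
    Matrix (BitString m) (BitString m) ℂ :=
  Matrix.diagonal (jwSign i) * applyGate (oddMatrix M (-M.adjugate)) i j

lemma eq_flipBit_left_iff {i j : Fin m} (hij : i ≠ j) {r s : BitString m}
    (h : ∀ l, l ≠ i → l ≠ j → r l = s l) : s = flipBit r i ↔ s i = 1 - r i ∧ s j = r j := by
  constructor
  · rintro rfl
    exact ⟨flipBit_apply_self _ _, flipBit_apply_of_ne _ hij.symm⟩
  · rintro ⟨h1, h2⟩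
    funext l
    by_cases hi : l = i
    · rw [hi, h1, flipBit_apply_self]
    · rw [flipBit_apply_of_ne _ hi]
      by_cases hj : l = j
      · rw [hj, h2]
      · exact (h l hi hj).symm

lemma agree_of_eq_flipBit {r s : BitString m} {q l : Fin m} (h : s = flipBit r q) (hl : l ≠ q) :
    r l = s l := by
  rw [h, flipBit_apply_of_ne _ hl]

/-- The form `-M.adjugate` of the second block comes from here: each ladder operator at `i` or `j`
has one entry in each block, and the sign that qubit `i` gives to operators at `j` relates the two
entries in this way. -/
lemma oddPair_eq {i j : Fin m} (hij : (j : ℕ) = i + 1) (M : Matrix (Fin 2) (Fin 2) ℂ) :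
    oddPair i j M = M 0 1 • ladder i 0 + M 1 0 • ladder i 1 +
      M 0 0 • ladder j 0 - M 1 1 • ladder j 1 := by
  have hne : i ≠ j := by rintro rfl; omega
  ext r s
  simp only [oddPair, Matrix.diagonal_mul, Matrix.sub_apply, Matrix.add_apply, Matrix.smul_apply,
    ladder, applyGate, jwSign_of_succ hij, smul_eq_mul]
  by_cases h : ∀ l, l ≠ i → l ≠ j → r l = s l
  · simp only [if_pos h, eq_flipBit_left_iff hne h,
      eq_flipBit_left_iff (i := j) (j := i) hne.symm fun l hj hi => h l hi hj]
    generalize r i = ri, r j = rj, s i = si, s j = sj, jwSign i r = σ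
    fin_cases ri <;> fin_cases rj <;> fin_cases si <;> fin_cases sj <;>
      simp [oddMatrix, bitSign, Matrix.adjugate_fin_two, mul_comm]
  · have hi : s ≠ flipBit r i := fun e => h fun l hl _ => agree_of_eq_flipBit e hl
    have hj : s ≠ flipBit r j := fun e => h fun l _ hl => agree_of_eq_flipBit e hl
    simp [h, hi, hj]

lemma diagonal_jwSign_mul_applyGate {i j q : Fin m} (hi : q ≤ i) (hj : q ≤ j)
    (G : Matrix (Fin 2 × Fin 2) (Fin 2 × Fin 2) ℂ) :
    Matrix.diagonal (jwSign q) * applyGate G i j =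
      applyGate G i j * Matrix.diagonal (jwSign q) := by
  ext r s
  rw [Matrix.diagonal_mul, Matrix.mul_diagonal, applyGate, mul_comm]
  split_ifs with h
  · rw [jwSign_congr fun l hl => h l (hl.trans_le hi).ne (hl.trans_le hj).ne]
  · simp

lemma oddPair_mul_applyGate {i j : Fin m} (hij : (j : ℕ) = i + 1)
    {A B : Matrix (Fin 2) (Fin 2) ℂ} (hA : A.det = 1) (hB : B.det = 1)
    (M : Matrix (Fin 2) (Fin 2) ℂ) :
    oddPair i j M * applyGate (matchgateMatrix A B) i j =
      applyGate (matchgateMatrix A B) i j * oddPair i j (A.adjugate * M * B) := by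
  have hne : i ≠ j := by rintro rfl; omega
  have hle : i ≤ j := by rw [Fin.le_def]; omega
  rw [oddPair, oddPair, Matrix.mul_assoc, ← applyGate_mul hne,
    oddMatrix_adjugate_mul_matchgateMatrix hA hB, applyGate_mul hne, ← Matrix.mul_assoc,
    ← Matrix.mul_assoc, diagonal_jwSign_mul_applyGate le_rfl hle]

/-- Matchgates preserve parity. -/
lemma matchgateMatrix_bitSign {A B : Matrix (Fin 2) (Fin 2) ℂ} {r s : Fin 2 × Fin 2}
    (h : matchgateMatrix A B r s ≠ 0) :
    bitSign r.1 * bitSign r.2 = bitSign s.1 * bitSign s.2 := by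
  obtain ⟨r₁, r₂⟩ := r
  obtain ⟨s₁, s₂⟩ := s
  revert h
  fin_cases r₁ <;> fin_cases r₂ <;> fin_cases s₁ <;> fin_cases s₂ <;>
    simp [matchgateMatrix, bitSign]

/-- No `q` lies strictly between neighbors. If `q` precedes both, its sign does not see them; if it
follows both, parity preservation applies. -/
lemma applyGate_matchgateMatrix_mul_jwSign {i j q : Fin m} (hij : (j : ℕ) = i + 1) (hi : q ≠ i)
    (hj : q ≠ j) (A B : Matrix (Fin 2) (Fin 2) ℂ) (r s : BitString m) :
    jwSign q r * applyGate (matchgateMatrix A B) i j r s =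
      jwSign q s * applyGate (matchgateMatrix A B) i j r s := by
  have hne : i ≠ j := by rintro rfl; omega
  rw [applyGate]
  split_ifs with h
  · by_cases h0 : matchgateMatrix A B (r i, r j) (s i, s j) = 0
    · simp [h0]
    · congr 1
      rcases lt_or_gt_of_ne hi with hlt | hgt
      · refine jwSign_congr fun l hl => h l (hl.trans hlt).ne ?_
        rintro rfl
        rw [Fin.lt_def] at hl hlt
        omega
      · refine jwSign_eq_of_agree_off_pair hne hgt ?_ h (matchgateMatrix_bitSign h0)
        rw [Fin.lt_def] at *
        rw [Ne, Fin.ext_iff] at hj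
        omega
  · simp

lemma ladder_mul_applyGate_of_ne {i j q : Fin m} (hij : (j : ℕ) = i + 1) (hi : q ≠ i)
    (hj : q ≠ j) (b : Fin 2) (A B : Matrix (Fin 2) (Fin 2) ℂ) :
    ladder q b * applyGate (matchgateMatrix A B) i j =
      applyGate (matchgateMatrix A B) i j * ladder q b := by
  ext r s
  have hl : (ladder q b * applyGate (matchgateMatrix A B) i j) r s =
      if r q = b then jwSign q r * applyGate (matchgateMatrix A B) i j (flipBit r q) s else 0 := by
    rw [Matrix.mul_apply, Finset.sum_eq_single (flipBit r q)]
    · simp [ladder]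
    · intro t _ ht
      simp [ladder, ht]
    · simp
  have hr : (applyGate (matchgateMatrix A B) i j * ladder q b) r s =
      if flipBit s q q = b then
        applyGate (matchgateMatrix A B) i j r (flipBit s q) * jwSign q s else 0 := by
    rw [Matrix.mul_apply, Finset.sum_eq_single (flipBit s q)]
    · simp [ladder, flipBit_flipBit, jwSign_flipBit]
    · intro t _ ht
      have : ¬ s = flipBit t q := fun e => ht (eq_flipBit_iff.mp e)
      simp [ladder, this]
    · simp
  have hgate : applyGate (matchgateMatrix A B) i j (flipBit r q) s =
      applyGate (matchgateMatrix A B) i j r (flipBit s q) := by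
    have hagree : (∀ l, l ≠ i → l ≠ j → flipBit r q l = s l) ↔
        ∀ l, l ≠ i → l ≠ j → r l = flipBit s q l := by
      refine forall_congr' fun l => forall_congr' fun _ => forall_congr' fun _ => ?_
      by_cases h : l = q
      · subst h
        rw [flipBit_apply_self, flipBit_apply_self]
        generalize r l = a, s l = c
        revert a c
        decide
      · rw [flipBit_apply_of_ne _ h, flipBit_apply_of_ne _ h]
    simp only [applyGate, hagree, flipBit_apply_of_ne _ hi.symm, flipBit_apply_of_ne _ hj.symm]
  rw [hl, hr, hgate]
  by_cases hq : r q = flipBit s q q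
  · rw [hq, mul_comm _ (jwSign q s), ← jwSign_flipBit q s,
      applyGate_matchgateMatrix_mul_jwSign hij hi hj]
  · have h0 : applyGate (matchgateMatrix A B) i j r (flipBit s q) = 0 := by
      rw [applyGate, if_neg]
      exact fun h => hq (h q hi hj)
    simp [h0]

/-- The space of linear combinations of ladder operators. -/
noncomputable def ladderSpan (m : ℕ) : Submodule ℂ (Matrix (BitString m) (BitString m) ℂ) :=
  Submodule.span ℂ (Set.range fun qb : Fin m × Fin 2 => ladder qb.1 qb.2)

lemma ladder_mem_ladderSpan (q : Fin m) (b : Fin 2) : ladder q b ∈ ladderSpan m :=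
  Submodule.subset_span ⟨(q, b), rfl⟩

lemma oddPair_mem_ladderSpan {i j : Fin m} (hij : (j : ℕ) = i + 1)
    (M : Matrix (Fin 2) (Fin 2) ℂ) : oddPair i j M ∈ ladderSpan m := by
  rw [oddPair_eq hij]
  exact sub_mem (add_mem (add_mem (Submodule.smul_mem _ _ (ladder_mem_ladderSpan _ _))
    (Submodule.smul_mem _ _ (ladder_mem_ladderSpan _ _)))
    (Submodule.smul_mem _ _ (ladder_mem_ladderSpan _ _)))
    (Submodule.smul_mem _ _ (ladder_mem_ladderSpan _ _))

lemma exists_oddPair_eq_ladder {i j q : Fin m} (hij : (j : ℕ) = i + 1) (hq : q = i ∨ q = j)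
    (b : Fin 2) : ∃ M, ladder q b = oddPair i j M := by
  rcases hq with rfl | rfl <;> fin_cases b
  · exact ⟨!![0, 1; 0, 0], by simp [oddPair_eq hij]⟩
  · exact ⟨!![0, 0; 1, 0], by simp [oddPair_eq hij]⟩
  · exact ⟨!![1, 0; 0, 0], by simp [oddPair_eq hij]⟩
  · exact ⟨!![0, 0; 0, -1], by simp [oddPair_eq hij]⟩

/-- Conjugation by a matchgate circuit preserves the span of the ladder operators. -/
lemma exists_ladderSpan_mul_eq {U : Matrix (BitString m) (BitString m) ℂ}
    (hU : U ∈ matchgateCircuits m) :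
    ∀ T ∈ ladderSpan m, ∃ S ∈ ladderSpan m, T * U = U * S := by
  induction hU using Submonoid.closure_induction with
  | mem U hU =>
    obtain ⟨G, ⟨A, hA, B, hB, rfl⟩, i, j, hij, rfl⟩ := hU
    intro T hT
    induction hT using Submodule.span_induction with
    | mem T hT =>
      obtain ⟨⟨q, b⟩, rfl⟩ := hT
      by_cases hq : q = i ∨ q = j
      · obtain ⟨M, hM⟩ := exists_oddPair_eq_ladder hij hq b
        refine ⟨_, oddPair_mem_ladderSpan hij (A.adjugate * M * B), ?_⟩
        dsimp only
        rw [hM, oddPair_mul_applyGate hij (Matrix.mem_specialUnitaryGroup_iff.mp hA).2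
          (Matrix.mem_specialUnitaryGroup_iff.mp hB).2]
      · rw [not_or] at hq
        exact ⟨_, ladder_mem_ladderSpan q b, ladder_mul_applyGate_of_ne hij hq.1 hq.2 b A B⟩
    | zero => exact ⟨0, zero_mem _, by simp⟩
    | add T T' _ _ h h' =>
      obtain ⟨S, hS, e⟩ := h
      obtain ⟨S', hS', e'⟩ := h'
      exact ⟨S + S', add_mem hS hS', by rw [Matrix.add_mul, Matrix.mul_add, e, e']⟩
    | smul c T _ h =>
      obtain ⟨S, hS, e⟩ := h
      exact ⟨c • S, Submodule.smul_mem _ _ hS, by rw [Matrix.smul_mul, Matrix.mul_smul, e]⟩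
  | one => exact fun T hT => ⟨T, hT, by simp⟩
  | mul U V _ _ hU hV =>
    intro T hT
    obtain ⟨S, hS, e⟩ := hU T hT
    obtain ⟨R, hR, e'⟩ := hV S hS
    exact ⟨R, hR, by rw [← Matrix.mul_assoc, e, Matrix.mul_assoc, e', Matrix.mul_assoc]⟩

end LadderOperators

/-! ### Outcome probabilities and the bound on the number of relevant bits. -/

section Probability

variable {m : ℕ}

lemma sum_norm_sq_mulVec_of_conjTranspose_mul_self {U : Matrix (BitString m) (BitString m) ℂ}
    (hU : Uᴴ * U = 1) (ψ : BitString m → ℂ) :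
    ∑ z, ‖(U *ᵥ ψ) z‖ ^ 2 = ∑ z, ‖ψ z‖ ^ 2 := by
  have key : ∀ φ : BitString m → ℂ, ((∑ z, ‖φ z‖ ^ 2 : ℝ) : ℂ) = star φ ⬝ᵥ φ := by
    intro φ
    simp only [dotProduct, Pi.star_apply, RCLike.star_def, Complex.conj_mul']
    push_cast
    rfl
  have h : star (U *ᵥ ψ) ⬝ᵥ (U *ᵥ ψ) = star ψ ⬝ᵥ ψ := by
    rw [Matrix.star_mulVec, Matrix.dotProduct_mulVec, Matrix.vecMul_vecMul, hU, Matrix.vecMul_one]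
  rw [← key, ← key] at h
  exact_mod_cast h

lemma sum_norm_sq_basisState (y : BitString m) : ∑ z, ‖basisState y z‖ ^ 2 = 1 := by
  rw [Finset.sum_eq_single y]
  · simp [basisState]
  · intro z _ hz
    simp [basisState, hz]
  · simp

lemma outcomeProb_add (ψ : BitString m → ℂ) (q : Fin m) (b : Fin 2) :
    outcomeProb ψ q b + outcomeProb ψ q (1 - b) = ∑ z, ‖ψ z‖ ^ 2 := by
  rw [outcomeProb, outcomeProb, ← Finset.sum_add_distrib]
  refine Finset.sum_congr rfl fun z _ => ?_
  by_cases h : z q = b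
  · simp [h, (one_sub_ne_self b).symm]
  · simp [eq_one_sub_of_ne h, one_sub_ne_self b]

/-- The ladder operator kills the component with `q` equal to `b` and permutes the remaining basis
states up to sign. -/
lemma sum_norm_sq_ladder_mulVec (q : Fin m) (b : Fin 2) (ψ : BitString m → ℂ) :
    ∑ z, ‖(ladder q b *ᵥ ψ) z‖ ^ 2 = outcomeProb ψ q (1 - b) := by
  rw [outcomeProb]
  refine Finset.sum_nbij' (fun z => flipBit z q) (fun z => flipBit z q) (by simp) (by simp)
    (fun z _ => flipBit_flipBit z q) (fun z _ => flipBit_flipBit z q) fun z _ => ?_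
  rw [ladder_mulVec, flipBit_apply_self]
  by_cases h : z q = b
  · simp [h, norm_jwSign]
  · simp [h]

/-- For each `q` only the operator setting `y q` to `1 - y q` survives; the resulting strings
`flipBit y q` are distinct, so there are no cross terms. -/
lemma sum_smul_ladder_mulVec_basisState (α : Fin m → Fin 2 → ℂ) (y : BitString m) :
    ∑ z, ‖((∑ q, ∑ b, α q b • ladder q b) *ᵥ basisState y) z‖ ^ 2 =
      ∑ q, ‖α q (1 - y q)‖ ^ 2 := by
  have hentry : ∀ z, ((∑ q, ∑ b, α q b • ladder q b) *ᵥ basisState y) z =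
      ∑ q, if z = flipBit y q then α q (1 - y q) * jwSign q y else 0 := by
    intro z
    rw [basisState, Matrix.mulVec_single_one, Matrix.col_apply, Matrix.sum_apply]
    refine Finset.sum_congr rfl fun q _ => ?_
    rw [Matrix.sum_apply, Finset.sum_eq_single (z q)]
    · by_cases h : z = flipBit y q
      · simp [h, ladder, flipBit_apply_self, flipBit_flipBit, jwSign_flipBit]
      · have : ¬ y = flipBit z q := fun e => h (eq_flipBit_iff.mp e)
        simp [h, ladder, this]
    · intro b _ hb
      simp [ladder, hb.symm]
    · simp
  have himage : ∀ q, ((∑ q, ∑ b, α q b • ladder q b) *ᵥ basisState y) (flipBit y q) =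
      α q (1 - y q) * jwSign q y := by
    intro q
    rw [hentry, Finset.sum_eq_single q]
    · simp
    · intro k _ hk
      rw [if_neg]
      exact fun e => hk (flipBit_injective y e).symm
    · simp
  symm
  refine Finset.sum_of_injOn (flipBit y) (flipBit_injective y).injOn (by simp) ?_ ?_
  · intro z _ hz
    rw [hentry, Finset.sum_eq_zero]
    · simp
    · intro q _
      rw [if_neg]
      rintro rfl
      exact hz ⟨q, by simp, rfl⟩
  · intro q _
    rw [himage, norm_mul, norm_jwSign, mul_one]

lemma exists_eq_sum_of_mem_ladderSpan {S : Matrix (BitString m) (BitString m) ℂ}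
    (hS : S ∈ ladderSpan m) : ∃ α : Fin m → Fin 2 → ℂ, S = ∑ q, ∑ b, α q b • ladder q b := by
  obtain ⟨c, hc⟩ := (Submodule.mem_span_range_iff_exists_fun ℂ).mp hS
  refine ⟨fun q b => c (q, b), ?_⟩
  rw [← hc, Fintype.sum_prod_type]

lemma conjTranspose_sum_smul_ladder (α : Fin m → Fin 2 → ℂ) :
    (∑ q, ∑ b, α q b • ladder q b)ᴴ = ∑ q, ∑ b, star (α q (1 - b)) • ladder q b := by
  rw [Matrix.conjTranspose_sum]
  refine Finset.sum_congr rfl fun q _ => ?_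
  rw [Matrix.conjTranspose_sum]
  simp only [Matrix.conjTranspose_smul, ladder_conjTranspose, Fin.sum_univ_two, sub_zero, sub_self]
  exact add_comm _ _

/-- The outcome probabilities of a matchgate circuit are linear functions of the input bits, and
the weights of all bits and values sum up to one. -/
lemma exists_weights {U : Matrix (BitString m) (BitString m) ℂ} (hU : U ∈ matchgateCircuits m)
    (q₀ : Fin m) : ∃ w : Fin m → Fin 2 → ℝ, (∀ q b, 0 ≤ w q b) ∧
      (∀ y b, outcomeProb (U *ᵥ basisState y) q₀ b = ∑ q, w q (b - y q)) ∧
      ∑ q, (w q 0 + w q 1) = 1 := by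
  have hUU := conjTranspose_mul_self_of_mem_circuits hU
  obtain ⟨S, hS, hSU⟩ := exists_ladderSpan_mul_eq hU _ (ladder_mem_ladderSpan q₀ 0)
  -- The creation operator is treated by taking adjoints, so that both outcomes are governed by the
  -- same coefficients `α`.
  have hSU' : ladder q₀ 1 * U = U * Sᴴ := by
    have h1 : S = Uᴴ * (ladder q₀ 0 * U) := by
      rw [hSU, ← Matrix.mul_assoc, hUU, Matrix.one_mul]
    rw [h1, Matrix.conjTranspose_mul, Matrix.conjTranspose_mul, Matrix.conjTranspose_conjTranspose,
      ladder_conjTranspose, sub_zero, Matrix.mul_assoc, ← Matrix.mul_assoc U,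
      mul_eq_one_comm.mp hUU, Matrix.one_mul]
  have hprob : ∀ (b : Fin 2) (T : Matrix (BitString m) (BitString m) ℂ),
      ladder q₀ (1 - b) * U = U * T → ∀ y, outcomeProb (U *ᵥ basisState y) q₀ b =
        ∑ z, ‖(T *ᵥ basisState y) z‖ ^ 2 := by
    intro b T hT y
    rw [← sum_norm_sq_mulVec_of_conjTranspose_mul_self hUU, Matrix.mulVec_mulVec, ← hT,
      ← Matrix.mulVec_mulVec, sum_norm_sq_ladder_mulVec, one_sub_one_sub]
  obtain ⟨α, rfl⟩ := exists_eq_sum_of_mem_ladderSpan hS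
  have hp : ∀ y b, outcomeProb (U *ᵥ basisState y) q₀ b = ∑ q, ‖α q (b - y q)‖ ^ 2 := by
    intro y b
    fin_cases b
    · change outcomeProb (U *ᵥ basisState y) q₀ 0 = ∑ q, ‖α q (0 - y q)‖ ^ 2
      rw [hprob 0 _ hSU', conjTranspose_sum_smul_ladder, sum_smul_ladder_mulVec_basisState]
      refine Finset.sum_congr rfl fun q _ => ?_
      rw [norm_star, one_sub_one_sub]
      generalize y q = c
      fin_cases c <;> rfl
    · exact (hprob 1 _ hSU y).trans (sum_smul_ladder_mulVec_basisState _ _)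
  refine ⟨fun q b => ‖α q b‖ ^ 2, fun q b => by positivity, hp, ?_⟩
  -- At `y = 0` the two outcome probabilities are the sums of `w q 0` and of `w q 1`.
  have htotal := outcomeProb_add (U *ᵥ basisState 0) q₀ 0
  rw [hp, hp, sum_norm_sq_mulVec_of_conjTranspose_mul_self hUU, sum_norm_sq_basisState,
    ← Finset.sum_add_distrib] at htotal
  simpa using htotal

lemma padZero_flipBit {n : ℕ} (hnm : n ≤ m) (x : BitString n) (k : Fin n) :
    padZero m (flipBit x k) = flipBit (padZero m x) (Fin.castLE hnm k) := by
  funext l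
  by_cases h : l = Fin.castLE hnm k
  · subst h
    simp [padZero, flipBit_apply_self]
  · rw [flipBit_apply_of_ne _ h, padZero, padZero]
    split_ifs with hl
    · refine flipBit_apply_of_ne _ fun e => h ?_
      rw [← e]
      rfl
    · rfl

lemma weight_ge_of_dependsOnBit {n : ℕ} (hnm : n ≤ m) {f : BitString n → Fin 2} {p : ℝ}
    {w : Fin m → Fin 2 → ℝ} (hw : ∀ q b, 0 ≤ w q b)
    (hsum : ∑ q, (w q 0 + w q 1) = 1)
    (hf : ∀ x, p ≤ ∑ q, w q (f x - padZero m x q)) {k : Fin n} (hk : DependsOnBit f k) :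
    2 * p - 1 ≤ w (Fin.castLE hnm k) 0 + w (Fin.castLE hnm k) 1 := by
  obtain ⟨x, hx⟩ := hk
  have h1 := hf x
  have h2 := hf (flipBit x k)
  rw [eq_one_sub_of_ne hx.symm, padZero_flipBit hnm] at h2
  set y := padZero m x
  set k' := Fin.castLE hnm k
  have hk' : k' ∈ Finset.univ := Finset.mem_univ _
  rw [← Finset.add_sum_erase _ _ hk'] at h1 h2 hsum
  -- Away from `k'` only the outcome is toggled, so the two inputs together use both weights of `q`.
  have h3 : ∑ q ∈ Finset.univ.erase k', w q (1 - f x - flipBit y k' q) +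
      ∑ q ∈ Finset.univ.erase k', w q (f x - y q) =
        ∑ q ∈ Finset.univ.erase k', (w q 0 + w q 1) := by
    rw [← Finset.sum_add_distrib]
    refine Finset.sum_congr rfl fun q hq => ?_
    rw [flipBit_apply_of_ne _ (Finset.ne_of_mem_erase hq)]
    generalize f x = a, y q = c
    fin_cases a <;> fin_cases c <;> simp [add_comm] <;> rfl
  -- At `k'` outcome and bit are both toggled, so the same weight occurs twice.
  have h4 : w k' (1 - f x - flipBit y k' k') = w k' (f x - y k') := by
    rw [flipBit_apply_self]
    congr 1
    generalize f x = a, y k' = c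
    revert a c
    decide
  have h5 : w k' (f x - y k') ≤ w k' 0 + w k' 1 := by
    generalize f x - y k' = a
    have h0 := hw k' 0
    have h1 := hw k' 1
    fin_cases a
    · exact le_add_of_nonneg_right h1
    · exact le_add_of_nonneg_left h0
  linarith

lemma isConstant_or_dependsOnSingleBit_of_computable {n : ℕ} {f : BitString n → Fin 2} {p : ℝ}
    (hp : 3 / 4 < p) (hf : MatchgateComputable f p) : IsConstant f ∨ DependsOnSingleBit f := by
  obtain ⟨m, hm, hnm, U, hU, hc⟩ := hf
  obtain ⟨w, hw, hprob, hsum⟩ := exists_weights hU ⟨0, hm⟩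
  have hf : ∀ x, p ≤ ∑ q, w q (f x - padZero m x q) := fun x => by
    rw [← hprob]
    exact hc x
  refine isConstant_or_dependsOnSingleBit fun k l hk hl => ?_
  by_contra hkl
  have h1 := weight_ge_of_dependsOnBit hnm hw hsum hf hk
  have h2 := weight_ge_of_dependsOnBit hnm hw hsum hf hl
  have hne : Fin.castLE hnm k ≠ Fin.castLE hnm l := fun e => hkl (Fin.castLE_injective hnm e)
  have h3 := Finset.add_le_sum (f := fun q => w q 0 + w q 1)
    (fun q _ => add_nonneg (hw q 0) (hw q 1)) (Finset.mem_univ _) (Finset.mem_univ _) hne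
  linarith

end Probability

/-! ### Circuits that compute a single bit or a constant. -/

section Constructions

variable {m : ℕ}

/-- `U` maps every basis state `|z⟩` to `|g z⟩` up to a phase. -/
def Implements (U : Matrix (BitString m) (BitString m) ℂ) (g : BitString m → BitString m) : Prop :=
  ∀ z, ∃ c : ℂ, ‖c‖ = 1 ∧ U *ᵥ basisState z = c • basisState (g z)

lemma implements_one : Implements (1 : Matrix (BitString m) (BitString m) ℂ) id :=
  fun z => ⟨1, by simp, by simp⟩

lemma Implements.mul {U V : Matrix (BitString m) (BitString m) ℂ} {g h : BitString m → BitString m}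
    (hU : Implements U g) (hV : Implements V h) : Implements (U * V) (g ∘ h) := by
  intro z
  obtain ⟨c, hc, e⟩ := hV z
  obtain ⟨d, hd, e'⟩ := hU (h z)
  refine ⟨c * d, by rw [norm_mul, hc, hd, mul_one], ?_⟩
  rw [← Matrix.mulVec_mulVec, e, Matrix.mulVec_smul, e', smul_smul]
  rfl

lemma Implements.outcomeProb_eq_one {U : Matrix (BitString m) (BitString m) ℂ}
    {g : BitString m → BitString m} (hU : Implements U g) (z : BitString m) (q : Fin m) :
    outcomeProb (U *ᵥ basisState z) q (g z q) = 1 := by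
  obtain ⟨c, hc, e⟩ := hU z
  rw [e, outcomeProb, Finset.sum_eq_single (g z)]
  · simp [basisState, hc]
  · intro y _ hy
    simp [basisState, hy]
  · simp

lemma implements_applyGate {i j : Fin m} (hij : i ≠ j)
    {G : Matrix (Fin 2 × Fin 2) (Fin 2 × Fin 2) ℂ} {g : Fin 2 × Fin 2 → Fin 2 × Fin 2}
    (hG : ∀ s, ‖G (g s) s‖ = 1) (hG' : ∀ r s, r ≠ g s → G r s = 0) :
    Implements (applyGate G i j) fun z =>
      Function.update (Function.update z i (g (z i, z j)).1) j (g (z i, z j)).2 := by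
  intro z
  refine ⟨G (g (z i, z j)) (z i, z j), hG _, ?_⟩
  ext r
  rw [basisState, Matrix.mulVec_single_one, Matrix.col_apply, applyGate, Pi.smul_apply, basisState,
    smul_eq_mul]
  by_cases hr : r = Function.update (Function.update z i (g (z i, z j)).1) j (g (z i, z j)).2
  · rw [if_pos]
    · rw [hr]
      simp [hij]
    · intro l hi hj
      simp [hr, hi, hj]
  · rw [Pi.single_eq_of_ne hr, mul_zero]
    split_ifs with h
    · refine hG' _ _ fun e => hr ?_
      rw [← e]
      funext l
      by_cases hj : l = j
      · subst hj; simp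
      · by_cases hi : l = i
        · subst hi; simp [hj]
        · simp [hi, hj, h l hi hj]
    · rfl

lemma rotation_mem_specialUnitaryGroup :
    (!![0, 1; -1, 0] : Matrix (Fin 2) (Fin 2) ℂ) ∈ Matrix.specialUnitaryGroup (Fin 2) ℂ := by
  rw [Matrix.mem_specialUnitaryGroup_iff, Matrix.mem_unitaryGroup_iff]
  constructor
  · ext a b
    fin_cases a <;> fin_cases b <;> simp [Matrix.mul_apply, Fin.sum_univ_two, Matrix.star_apply]
  · simp

/-- The true swap has a block of determinant `-1`; changing one sign puts it in `SU(2)`, and the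
phase does not affect measurements. -/
lemma exists_implements_swap {i j : Fin m} (hij : (j : ℕ) = i + 1) :
    ∃ U ∈ matchgateCircuits m, ∃ g, Implements U g ∧ ∀ z, g z i = z j := by
  have hne : i ≠ j := by rintro rfl; omega
  refine ⟨_, Submonoid.subset_closure ⟨_, ⟨1, one_mem _, _, rotation_mem_specialUnitaryGroup, rfl⟩,
    i, j, hij, rfl⟩, _, implements_applyGate hne (g := Prod.swap) ?_ ?_, ?_⟩
  · rintro ⟨a, b⟩
    fin_cases a <;> fin_cases b <;> simp [matchgateMatrix, Matrix.one_apply]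
  · rintro ⟨a, b⟩ ⟨c, d⟩
    fin_cases a <;> fin_cases b <;> fin_cases c <;> fin_cases d <;> simp [matchgateMatrix]
  · intro z
    simp [hne]

/-- Up to phases the gate is `X ⊗ X`; its effect on the neighbor `j` is irrelevant. -/
lemma exists_implements_not {i j : Fin m} (hij : (j : ℕ) = i + 1) :
    ∃ U ∈ matchgateCircuits m, ∃ g, Implements U g ∧ ∀ z, g z i = 1 - z i := by
  have hne : i ≠ j := by rintro rfl; omega
  refine ⟨_, Submonoid.subset_closure ⟨_, ⟨_, rotation_mem_specialUnitaryGroup,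
    _, rotation_mem_specialUnitaryGroup, rfl⟩, i, j, hij, rfl⟩, _,
    implements_applyGate hne (g := fun s => (1 - s.1, 1 - s.2)) ?_ ?_, ?_⟩
  · rintro ⟨a, b⟩
    fin_cases a <;> fin_cases b <;> simp [matchgateMatrix]
  · rintro ⟨a, b⟩ ⟨c, d⟩
    fin_cases a <;> fin_cases b <;> fin_cases c <;> fin_cases d <;> simp [matchgateMatrix]
  · intro z
    simp [hne]

lemma exists_implements_move (hm : 0 < m) (k : ℕ) (hk : k < m) :
    ∃ U ∈ matchgateCircuits m, ∃ g, Implements U g ∧ ∀ z, g z ⟨0, hm⟩ = z ⟨k, hk⟩ := by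
  induction k with
  | zero => exact ⟨1, one_mem _, id, implements_one, fun z => rfl⟩
  | succ k ih =>
    obtain ⟨U, hU, g, hg, h⟩ := ih (by omega)
    obtain ⟨V, hV, g', hg', h'⟩ :=
      exists_implements_swap (i := (⟨k, by omega⟩ : Fin m)) (j := ⟨k + 1, hk⟩) rfl
    exact ⟨U * V, mul_mem hU hV, g ∘ g', hg.mul hg', fun z => by rw [Function.comp_apply, h, h']⟩

/-- Two extra qubits provide a padding zero and ensure that the first qubit has a neighbor for the
negation, even when `n = 0`. -/
lemma matchgateComputable_of_bit {n : ℕ} {f : BitString n → Fin 2} {p : ℝ} (hp : p ≤ 1)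
    (k : Fin (n + 2))
    (hf : (∀ x, f x = padZero (n + 2) x k) ∨ ∀ x, f x = 1 - padZero (n + 2) x k) :
    MatchgateComputable f p := by
  obtain ⟨U, hU, g, hg, h⟩ := exists_implements_move (m := n + 2) (by omega) k k.isLt
  refine ⟨n + 2, by omega, by omega, ?_⟩
  rcases hf with hf | hf
  · refine ⟨U, hU, fun x => ?_⟩
    rw [hf, ← h (padZero (n + 2) x), hg.outcomeProb_eq_one]
    exact hp
  · obtain ⟨V, hV, g', hg', h'⟩ :=
      exists_implements_not (m := n + 2) (i := ⟨0, by omega⟩) (j := ⟨1, by omega⟩) rfl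
    refine ⟨V * U, mul_mem hV hU, fun x => ?_⟩
    rw [hf, ← h (padZero (n + 2) x), ← h', ← Function.comp_apply (f := g'), (hg'.mul hg).outcomeProb_eq_one]
    exact hp

lemma matchgateComputable_of_isConstant {n : ℕ} {f : BitString n → Fin 2} {p : ℝ} (hp : p ≤ 1)
    (hf : IsConstant f) : MatchgateComputable f p := by
  obtain ⟨b, hb⟩ := hf
  -- Position `n` is the first padding zero: constants are this bit or its negation.
  refine matchgateComputable_of_bit hp ⟨n, by omega⟩ ?_
  simp only [hb, padZero, lt_irrefl, dite_false, forall_const, sub_zero]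
  clear hb
  revert b
  decide

lemma matchgateComputable_of_dependsOnSingleBit {n : ℕ} {f : BitString n → Fin 2} {p : ℝ}
    (hp : p ≤ 1) (hf : DependsOnSingleBit f) : MatchgateComputable f p := by
  obtain ⟨k, hk⟩ := dependsOnSingleBit_iff.mp hf
  refine matchgateComputable_of_bit hp (Fin.castLE (by omega) k) ?_
  simpa [padZero] using hk

end Constructions

end MatchgateLTG

theorem theorem2 (n : ℕ) (f : MatchgateLTG.BitString n → Fin 2) (p : ℝ)
    (hp : 3 / 4 < p) (hp1 : p ≤ 1) :
    (MatchgateLTG.MatchgateComputable f p ↔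
      MatchgateLTG.IsConstant f ∨ MatchgateLTG.DependsOnSingleBit f) ∧
    (MatchgateLTG.DependsOnSingleBit f ↔
      ∃ k : Fin n, (∀ x, f x = x k) ∨ (∀ x, f x = 1 - x k)) :=
  ⟨⟨MatchgateLTG.isConstant_or_dependsOnSingleBit_of_computable hp, fun h =>
      h.elim (MatchgateLTG.matchgateComputable_of_isConstant hp1)
        (MatchgateLTG.matchgateComputable_of_dependsOnSingleBit hp1)⟩,
    MatchgateLTG.dependsOnSingleBit_iff⟩
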